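/- Let $p$ be a prime, let $n,m\ge 1$, and let $F:\mathbb F_{p^n}\to\mathbb F_{p^m}$ be a function. Put $\zeta_p=e^{2\pi i/p}$, let $\mathrm{Tr}$ denote the absolute trace to $\mathbb F_p$ (of $\mathbb F_{p^n}$ or of $\mathbb F_{p^m}$), and for $b\in\mathbb F_{p^m}$, $a\in\mathbb F_{p^n}$ let $$W_F(b,a)=\sum_{x\in\mathbb F_{p^n}}\zeta_p^{\mathrm{Tr}(bF(x))-\mathrm{Tr}(ax)}$$ be the Walsh transform of $F$. Suppose that $F$ is plateaued, i.e. for every $b\neq 0$ there is an integer $0\le s_b\le n$ such that $|W_F(b,a)|\in\{0,p^{(n+s_b)/2}\}$ for all $a\in\mathbb F_{p^n}$. Suppose further that $F$ has a value distribution of one of the following two types: - type $(+)$: $|F^{-1}(0)|=p^{n-m}+p^{n/2}-p^{n/2-m}$ and $|F^{-1}(y)|=p^{n-m}-p^{n/2-m}$ for all $y\ne 0$; - type $(-)$: $|F^{-1}(0)|=p^{n-m}-p^{n/2}+p^{n/2-m}$ and $|F^{-1}(y)|=p^{n-m}+p^{n/2-m}$ for all $y\ne 0$. Then $F$ is bent,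 i.e. $|W_F(b,a)|=p^{n/2}$ for all $b\neq 0$ and all $a\in\mathbb F_{p^n}$, and equivalently $F$ is perfect nonlinear: for every $a\in\mathbb F_{p^n}\setminus\{0\}$ and every $c\in\mathbb F_{p^m}$ the equation $F(x+a)-F(x)=c$ has exactly $p^{n-m}$ solutions $x\in\mathbb F_{p^n}$. Moreover, $W_F(b,0)=p^{n/2}$ for all $b\neq 0$ if $F$ is of type $(+)$, and $W_F(b,0)=-p^{n/2}$ for all $b\ne 0$ if $F$ is of type $(-)$. -/

import Mathlib

namespace Plateaued

/-- The primitive `p`-th root of unity `ζ_p = e^{2πi/p}`. -/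
noncomputable def zeta (p : ℕ) : ℂ := Complex.exp (2 * Real.pi * Complex.I / p)

theorem zeta_pow_val (p : ℕ) [NeZero p] (z : ZMod p) :
    zeta p ^ z.val = ZMod.stdAddChar z := by
  rw [ZMod.stdAddChar_apply, ZMod.toCircle_apply, zeta, ← Complex.exp_nat_mul]
  congr 1
  ring

/-- The Walsh transform `W_f(a) = ∑_x ζ_p^{f(x) - ⟨a, x⟩}` of `f : K → 𝔽_p`, where `K` is a finite
field of characteristic `p` with the scalar product `⟨a, x⟩ = Tr(a x)` (absolute trace). -/
noncomputable def walsh (p : ℕ) {K : Type*} [Field K] [Fintype K] [Algebra (ZMod p) K]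
    (f : K → ZMod p) (a : K) : ℂ :=
  ∑ x : K, zeta p ^ (f x - Algebra.trace (ZMod p) K (a * x)).val

/-- The component function `F_b(x) = ⟨b, F(x)⟩ = Tr(b F(x))` of `F : K → L`. -/
noncomputable def component (p : ℕ) {K L : Type*} [Field L] [Algebra (ZMod p) L]
    (F : K → L) (b : L) : K → ZMod p :=
  fun x => Algebra.trace (ZMod p) L (b * F x)

/-- The Walsh transform `W_F(b, a) = W_{F_b}(a)` of a vectorial function. -/
noncomputable def walshV (p : ℕ) {K L : Type*} [Field K] [Fintype K] [Algebra (ZMod p) K]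
    [Field L] [Algebra (ZMod p) L] (F : K → L) (b : L) (a : K) : ℂ :=
  walsh p (component p F b) a

/-- `f : K → 𝔽_p` is bent: `|W_f(a)| = p^{n/2}` for all `a`, where `n = [K : 𝔽_p]`. -/
def IsBentScalar (p : ℕ) {K : Type*} [Field K] [Fintype K] [Algebra (ZMod p) K]
    (f : K → ZMod p) : Prop :=
  ∀ a : K, ‖walsh p f a‖ = (p : ℝ) ^ ((Module.finrank (ZMod p) K : ℝ) / 2)

/-- `F : K → L` is (vectorial) bent: all its components `F_b`, `b ≠ 0`, are bent. -/
def IsBent (p : ℕ) {K L : Type*} [Field K] [Fintype K] [Algebra (ZMod p) K]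
    [Field L] [Algebra (ZMod p) L] (F : K → L) : Prop :=
  ∀ b : L, b ≠ 0 → IsBentScalar p (component p F b)

/-- `F : G → H` is perfect nonlinear: for all `a ≠ 0` and all `b`, the equation
`F(x + a) - F(x) = b` has exactly `|G| / |H|` solutions `x`. -/
def IsPerfectNonlinear {G H : Type*} [AddGroup G] [AddGroup H] (F : G → H) : Prop :=
  ∀ a : G, a ≠ 0 → ∀ b : H,
    ({x : G | F (x + a) - F x = b}.ncard : ℝ) = (Nat.card G : ℝ) / (Nat.card H : ℝ)

/-- `F : K → L` is plateaued: for every `b ≠ 0` there is an integer `0 ≤ s_b ≤ n`, `n = [K : 𝔽_p]`,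
such that `|W_{F_b}(a)| ∈ {0, p^{(n + s_b)/2}}` for all `a`. -/
def IsPlateaued (p : ℕ) {K L : Type*} [Field K] [Fintype K] [Algebra (ZMod p) K]
    [Field L] [Algebra (ZMod p) L] (F : K → L) : Prop :=
  ∀ b : L, b ≠ 0 → ∃ s : ℕ, s ≤ Module.finrank (ZMod p) K ∧ ∀ a : K,
    ‖walsh p (component p F b) a‖ = 0 ∨
    ‖walsh p (component p F b) a‖ = (p : ℝ) ^ (((Module.finrank (ZMod p) K : ℝ) + s) / 2)

/-- The value distribution of `F : G → H` is extremal of type (-), with unique preimage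
`F⁻¹(α)`. -/
def IsTypeMinus {G H : Type*} (F : G → H) (α : H) : Prop :=
  ((F ⁻¹' {α}).ncard : ℝ) =
      (Nat.card G : ℝ) / Nat.card H - √(Nat.card G : ℝ) + √(Nat.card G : ℝ) / Nat.card H ∧
  ∀ β : H, β ≠ α → ((F ⁻¹' {β}).ncard : ℝ) =
      (Nat.card G : ℝ) / Nat.card H + √(Nat.card G : ℝ) / Nat.card H

/-- The value distribution of `F : G → H` is extremal of type (+), with unique preimage
`F⁻¹(α)`. -/
def IsTypePlus {G H : Type*} (F : G → H) (α : H) : Prop :=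
  ((F ⁻¹' {α}).ncard : ℝ) =
      (Nat.card G : ℝ) / Nat.card H + √(Nat.card G : ℝ) - √(Nat.card G : ℝ) / Nat.card H ∧
  ∀ β : H, β ≠ α → ((F ⁻¹' {β}).ncard : ℝ) =
      (Nat.card G : ℝ) / Nat.card H - √(Nat.card G : ℝ) / Nat.card H

end Plateaued

/-! Grouping the sum `W_F(b, 0)` by the values of `F`, the common size of the nonzero fibres
contributes nothing by orthogonality, so for `b ≠ 0` the sum is the difference of the two fibre
sizes, `±p^{n/2}` according to the type (`walshV_zero_of_two_valued`). This value is nonzero, so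
plateauedness makes `p^{n/2}` the only nonzero modulus of each component's spectrum; Parseval
(`sum_norm_walsh_sq`) then leaves no room for zeros, so `F` is bent. A flat power spectrum has
autocorrelation zero off the origin, and orthogonality on `L` turns this into perfect nonlinearity.
-/

namespace Plateaued

open scoped ComplexConjugate

section Characters

/-- The additive character `x ↦ ζ_p^{Tr(x)}` of a finite field of characteristic `p`. -/
noncomputable def traceChar (p : ℕ) [Fact p.Prime] (K : Type*) [Field K] [Algebra (ZMod p) K] :
    AddChar K ℂ :=
  (ZMod.stdAddChar (N := p)).compAddMonoidHom (Algebra.trace (ZMod p) K).toAddMonoidHom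

theorem traceChar_apply {p : ℕ} [Fact p.Prime] {K : Type*} [Field K] [Algebra (ZMod p) K]
    (x : K) :
    traceChar p K x = ZMod.stdAddChar (Algebra.trace (ZMod p) K x) := rfl

variable {p : ℕ} [Fact p.Prime] {K : Type*} [Field K] [Fintype K] [Algebra (ZMod p) K]

/-- On a field every nontrivial additive character is primitive, and this one is nontrivial because
the trace of a finite field is nonzero. -/
theorem traceChar_isPrimitive : (traceChar p K).IsPrimitive := by
  apply AddChar.IsPrimitive.of_ne_one
  intro h
  have htr : Algebra.trace (ZMod p) K = 0 := by
    ext x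
    have hx : (ZMod.stdAddChar (Algebra.trace (ZMod p) K x) : ℂ) = ZMod.stdAddChar (0 : ZMod p) := by
      rw [← traceChar_apply, h]
      simp
    exact ZMod.injective_stdAddChar hx
  have : Module.Finite (ZMod p) K := Module.Finite.of_finite
  exact Algebra.trace_ne_zero (ZMod p) K htr

theorem sum_traceChar_mul [DecidableEq K] (a : K) :
    ∑ u : K, traceChar p K (u * a) = if a = 0 then (Fintype.card K : ℂ) else 0 := by
  rw [AddChar.sum_mulShift a traceChar_isPrimitive]
  split_ifs <;> simp

theorem walsh_eq_sum (f : K → ZMod p) (u : K) :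
    walsh p f u = ∑ x : K, ZMod.stdAddChar (f x) * traceChar p K (-(u * x)) := by
  refine Finset.sum_congr rfl fun x _ => ?_
  rw [zeta_pow_val, sub_eq_add_neg, AddChar.map_add_eq_mul, traceChar_apply,
    map_neg (Algebra.trace (ZMod p) K)]

/-- The Fourier transform of the power spectrum is the autocorrelation. -/
theorem sum_walsh_mul_conj_mul_traceChar (f : K → ZMod p) (a : K) :
    ∑ u : K, walsh p f u * conj (walsh p f u) * traceChar p K (u * a) =
      Fintype.card K * ∑ y : K, (ZMod.stdAddChar (f (y + a) - f y) : ℂ) := by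
  classical
  -- The index `y` comes from the conjugate factor. Summing over `u` will leave only the terms with
  -- `x = y + a`.
  have expand (u : K) : walsh p f u * conj (walsh p f u) * traceChar p K (u * a) =
      ∑ y : K, ∑ x : K,
        (ZMod.stdAddChar (f x - f y) : ℂ) * traceChar p K (u * (y + a - x)) := by
    rw [walsh_eq_sum, map_sum, mul_comm (∑ _, _), Finset.sum_mul_sum, Finset.sum_mul]
    refine Finset.sum_congr rfl fun y _ => ?_
    rw [Finset.sum_mul]
    refine Finset.sum_congr rfl fun x _ => ?_
    rw [map_mul, ← AddChar.map_neg_eq_conj, ← AddChar.map_neg_eq_conj, neg_neg,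
      sub_eq_add_neg (f x), AddChar.map_add_eq_mul,
      show u * (y + a - x) = u * y + -(u * x) + u * a by ring, AddChar.map_add_eq_mul,
      AddChar.map_add_eq_mul]
    ring
  simp_rw [expand]
  rw [Finset.sum_comm, Finset.mul_sum]
  refine Finset.sum_congr rfl fun y _ => ?_
  rw [Finset.sum_comm]
  simp_rw [← Finset.mul_sum, sum_traceChar_mul, sub_eq_zero]
  simp [mul_comm]

/-- Parseval's identity. -/
theorem sum_norm_walsh_sq (f : K → ZMod p) :
    ∑ u : K, ‖walsh p f u‖ ^ 2 = (Fintype.card K : ℝ) ^ 2 := by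
  have h := sum_walsh_mul_conj_mul_traceChar f 0
  simp only [Complex.mul_conj', mul_zero, AddChar.map_zero_eq_one, mul_one, add_zero, sub_self,
    Finset.sum_const, Finset.card_univ, nsmul_eq_mul] at h
  rw [← sq] at h
  exact_mod_cast h

theorem sqrt_card_eq_rpow :
    √(Nat.card K : ℝ) = (p : ℝ) ^ ((Module.finrank (ZMod p) K : ℝ) / 2) := by
  have : Module.Finite (ZMod p) K := Module.Finite.of_finite
  rw [Module.natCard_eq_pow_finrank (K := ZMod p), Nat.card_zmod, Nat.cast_pow,
    Real.sqrt_eq_rpow, ← Real.rpow_natCast, ← Real.rpow_mul p.cast_nonneg, mul_one_div]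

/-- A function all of whose Walsh values have absolute value `0` or `p^{n/2}` is bent. -/
theorem isBentScalar_of_norm_walsh {f : K → ZMod p}
    (h : ∀ a, ‖walsh p f a‖ = 0 ∨ ‖walsh p f a‖ = √(Nat.card K : ℝ)) : IsBentScalar p f := by
  have hle (a : K) : ‖walsh p f a‖ ^ 2 ≤ Fintype.card K := by
    rcases h a with h | h <;> rw [h]
    · simp
    · rw [Real.sq_sqrt (Nat.cast_nonneg _), Nat.card_eq_fintype_card]
  have hsum : ∑ u : K, ‖walsh p f u‖ ^ 2 = ∑ _u : K, (Fintype.card K : ℝ) := by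
    rw [sum_norm_walsh_sq]
    simp [sq]
  intro a
  -- Equal sums together with a termwise bound force equality in every term.
  have ha := (Finset.sum_eq_sum_iff_of_le fun u _ => hle u).1 hsum a (Finset.mem_univ a)
  rw [← sqrt_card_eq_rpow, Nat.card_eq_fintype_card, ← ha, Real.sqrt_sq (norm_nonneg _)]

/-- The derivatives of a bent function in nonzero directions are balanced. -/
theorem IsBentScalar.sum_derivative {f : K → ZMod p} (h : IsBentScalar p f) {a : K} (ha : a ≠ 0) :
    ∑ x : K, (ZMod.stdAddChar (f (x + a) - f x) : ℂ) = 0 := by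
  classical
  have key := sum_walsh_mul_conj_mul_traceChar f a
  -- Since `|W_f|²` is constant, it factors out and leaves a complete character sum, which is zero
  -- for `a ≠ 0`.
  simp_rw [Complex.mul_conj', h _, ← Finset.mul_sum, sum_traceChar_mul, if_neg ha, mul_zero] at key
  exact (mul_eq_zero.1 key.symm).resolve_left (Nat.cast_ne_zero.2 Fintype.card_ne_zero)

/-- A plateaued function with `|W_F(b, 0)| = p^{n/2}` for all `b ≠ 0` is bent. -/
theorem IsPlateaued.isBent {L : Type*} [Field L] [Algebra (ZMod p) L] {F : K → L}
    (hF : IsPlateaued p F)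
    (h : ∀ b : L, b ≠ 0 → ‖walshV p F b 0‖ = √(Nat.card K : ℝ)) : IsBent p F := by
  intro b hb
  obtain ⟨s, -, hs⟩ := hF b hb
  have hval : (p : ℝ) ^ (((Module.finrank (ZMod p) K : ℝ) + s) / 2) = √(Nat.card K : ℝ) := by
    have h0 : ‖walsh p (component p F b) 0‖ = √(Nat.card K : ℝ) := h b hb
    have hpos : 0 < √(Nat.card K : ℝ) := Real.sqrt_pos.2 (Nat.cast_pos.2 Nat.card_pos)
    rcases hs 0 with hz | hz
    · exact absurd (h0.symm.trans hz) hpos.ne'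
    · exact hz.symm.trans h0
  exact isBentScalar_of_norm_walsh fun a => hval ▸ hs a

end Characters

section Vectorial

variable {p : ℕ} [Fact p.Prime] {K L : Type*} [Field K] [Fintype K] [Algebra (ZMod p) K]
  [Field L] [Fintype L] [Algebra (ZMod p) L]

/-- Double counting: summing over `b` first detects the solutions, while summing over `x` first
kills every `b ≠ 0` because derivatives of bent components are balanced. -/
theorem IsBent.isPerfectNonlinear {F : K → L} (h : IsBent p F) : IsPerfectNonlinear F := by
  classical
  intro a ha c
  have orth : ∑ x : K, ∑ b : L, traceChar p L (b * (F (x + a) - F x - c)) =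
      Fintype.card L * ({x : K | F (x + a) - F x = c}.ncard : ℂ) := by
    simp_rw [sum_traceChar_mul, sub_eq_zero (b := c)]
    rw [Finset.sum_ite, Finset.sum_const_zero, add_zero, Finset.sum_const, nsmul_eq_mul, mul_comm,
      ← Set.ncard_coe_finset]
    simp
  have vanish : ∑ x : K, ∑ b : L, traceChar p L (b * (F (x + a) - F x - c)) = Fintype.card K := by
    rw [Finset.sum_comm, Finset.sum_eq_single 0]
    · simp
    · intro b _ hb
      have hsplit (x : K) : traceChar p L (b * (F (x + a) - F x - c)) =
          (ZMod.stdAddChar (component p F b (x + a) - component p F b x) : ℂ) *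
            traceChar p L (-(b * c)) := by
        rw [show b * (F (x + a) - F x - c) = (b * F (x + a) - b * F x) + -(b * c) by ring,
          AddChar.map_add_eq_mul, traceChar_apply, map_sub]
        rfl
      simp_rw [hsplit, ← Finset.sum_mul, (h b hb).sum_derivative ha, zero_mul]
    · simp
  have key : (Fintype.card L : ℝ) * ({x : K | F (x + a) - F x = c}.ncard : ℝ) = Fintype.card K := by
    exact_mod_cast orth.symm.trans vanish
  rw [Nat.card_eq_fintype_card, Nat.card_eq_fintype_card,
    eq_div_iff (Nat.cast_ne_zero.2 Fintype.card_ne_zero), mul_comm, key]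

/-- If all `β ≠ 0` have the same number of preimages, then `W_F(b, 0)`, `b ≠ 0`, is the difference
of the two preimage sizes. -/
theorem walshV_zero_of_two_valued {F : K → L} {s t : ℝ} (h0 : ((F ⁻¹' {0}).ncard : ℝ) = s)
    (h1 : ∀ β : L, β ≠ 0 → ((F ⁻¹' {β}).ncard : ℝ) = t) {b : L} (hb : b ≠ 0) :
    walshV p F b 0 = ((s - t : ℝ) : ℂ) := by
  classical
  have hwalsh : walshV p F b 0 = ∑ x : K, traceChar p L (F x * b) := by
    rw [walshV, walsh_eq_sum]
    refine Finset.sum_congr rfl fun x _ => ?_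
    rw [zero_mul, neg_zero, AddChar.map_zero_eq_one, mul_one, mul_comm]
    rfl
  -- The fibre sizes are a constant `t` plus a spike `s - t` at `0`; the constant part cancels on
  -- summing over `β`, since `b ≠ 0`.
  have hfib (β : L) : ∑ x : K with F x = β, traceChar p L (F x * b) =
      (if β = 0 then ((s - t : ℝ) : ℂ) else 0) + t * traceChar p L (β * b) := by
    have hcard : ((F ⁻¹' {β}).ncard : ℝ) = (if β = 0 then s - t else 0) + t := by
      split_ifs with hβ
      · rw [hβ, h0, sub_add_cancel]
      · rw [h1 β hβ, zero_add]
    have hset : (F ⁻¹' {β}).ncard = (Finset.univ.filter fun x : K => F x = β).card := by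
      rw [← Set.ncard_coe_finset]
      congr 1
      ext x
      simp
    have hC : ((F ⁻¹' {β}).ncard : ℂ) = (((if β = 0 then s - t else 0) + t : ℝ) : ℂ) := by
      rw [← hcard, Complex.ofReal_natCast]
    rw [Finset.sum_congr rfl (g := fun _ => traceChar p L (β * b))
      (fun x hx => by rw [(Finset.mem_filter.1 hx).2]), Finset.sum_const, nsmul_eq_mul, ← hset, hC]
    split_ifs with hβ
    · simp [hβ]
    · simp
  rw [hwalsh, ← Finset.sum_fiberwise (g := F)]
  simp_rw [hfib]
  rw [Finset.sum_add_distrib, ← Finset.mul_sum, sum_traceChar_mul, if_neg hb]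
  simp

theorem IsTypePlus.walshV_zero {F : K → L} (h : IsTypePlus F 0) {b : L} (hb : b ≠ 0) :
    walshV p F b 0 = (√(Nat.card K : ℝ) : ℂ) := by
  rw [walshV_zero_of_two_valued h.1 h.2 hb]
  congr 1
  ring

theorem IsTypeMinus.walshV_zero {F : K → L} (h : IsTypeMinus F 0) {b : L} (hb : b ≠ 0) :
    walshV p F b 0 = -(√(Nat.card K : ℝ) : ℂ) := by
  rw [walshV_zero_of_two_valued h.1 h.2 hb, ← Complex.ofReal_neg]
  congr 1
  ring

end Vectorial

end Plateaued

theorem mainTheorem3 (p n m : ℕ) [Fact p.Prime]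
    {K L : Type*} [Field K] [Fintype K] [Algebra (ZMod p) K]
    [Field L] [Fintype L] [Algebra (ZMod p) L]
    (hK : Nat.card K = p ^ n) (hL : Nat.card L = p ^ m)
    (F : K → L) (hF : Plateaued.IsPlateaued p F)
    (hdist : Plateaued.IsTypePlus F 0 ∨ Plateaued.IsTypeMinus F 0) :
    (Plateaued.IsBent p F ∧ Plateaued.IsPerfectNonlinear F) ∧
    (Plateaued.IsTypePlus F 0 →
      ∀ b : L, b ≠ 0 → Plateaued.walshV p F b 0 = (((p : ℝ) ^ ((n : ℝ) / 2) : ℝ) : ℂ)) ∧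
    (Plateaued.IsTypeMinus F 0 →
      ∀ b : L, b ≠ 0 → Plateaued.walshV p F b 0 = -(((p : ℝ) ^ ((n : ℝ) / 2) : ℝ) : ℂ)) := by
  have hsqrt : √(Nat.card K : ℝ) = (p : ℝ) ^ ((n : ℝ) / 2) := by
    rw [hK, Nat.cast_pow, Real.sqrt_eq_rpow, ← Real.rpow_natCast, ← Real.rpow_mul p.cast_nonneg,
      mul_one_div]
  have hbent : Plateaued.IsBent p F := hF.isBent fun b hb => by
    rcases hdist with h | h
    · rw [h.walshV_zero hb, Complex.norm_of_nonneg (Real.sqrt_nonneg _)]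
    · rw [h.walshV_zero hb, norm_neg, Complex.norm_of_nonneg (Real.sqrt_nonneg _)]
  refine ⟨⟨hbent, hbent.isPerfectNonlinear⟩, fun h b hb => ?_, fun h b hb => ?_⟩
  · rw [h.walshV_zero hb, hsqrt]
  · rw [h.walshV_zero hb, hsqrt]
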